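/- Let $P$ be a Borel probability distribution on $\mathbb{R}^d$ and $\mathbb{X}\subset\mathbb{R}^d$ a fixed subset. Write $\mathbb{B}(x,r)$ for the open Euclidean ball, and let $$d_{\mathrm{vol}}=\sup\Big\{\nu\ge 0:\ \limsup_{r\to0}\sup_{x\in\mathbb{X}}\frac{P(\mathbb{B}(x,r))}{r^{\nu}}<\infty\Big\}$$ be the volume dimension of $P$. Suppose that $0<d_{\mathrm{vol}}<\infty$ and that $$\sup_{x\in\mathbb{X}}\liminf_{r\to0}\frac{P(\mathbb{B}(x,r))}{r^{d_{\mathrm{vol}}}}>0.$$ Let $K:\mathbb{R}^d\to\mathbb{R}$ be a bounded measurable function with $$\int_0^\infty t^{d_{\mathrm{vol}}-1}\sup_{\|x\|\ge t}|K(x)|\,dt<\infty\qquad\text{and}\qquad \lim_{t\to0^+}\inf_{\|x\|\le t}K(x)>0 .$$ For an i.i.d. sample $X_1,\dots,X_n$ from $P$, $h>0$ and $x\in\mathbb{R}^d$ put $$\hat p_h(x)=\frac1{nh^d}\sum_{i=1}^nK\Big(\frac{x-X_i}{h}\Big),\qquad p_h(x)=\mathbb{E}[\hat p_h(x)].$$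 Then for every $\delta\in(0,1)$ there is a constant $C_{P,K,\delta}>0$, depending only on $P$, $K$, $\delta$ (and the fixed set $\mathbb{X}$), such that for every sequence $l_n>0$ with $l_n\to0$ and $n\,l_n^{d_{\mathrm{vol}}}\to\infty$ the following holds: for all sufficiently large $n$, with probability at least $1-\delta$, $$\sup_{h\ge l_n,\ x\in\mathbb{X}}\big|\hat p_h(x)-p_h(x)\big|\ \ge\ C_{P,K,\delta}\sqrt{\frac{1}{n\,l_n^{2d-d_{\mathrm{vol}}}}}.$$ -/

import Mathlib

open Set Filter Topology MeasureTheory ProbabilityTheory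
open scoped ENNReal

noncomputable section

/-- The exponents `ν ≥ 0` with `limsup_{r → 0} sup_{x ∈ 𝕏} P(B(x, r)) / r ^ ν < ∞`, where `B(x, r)`
is the open Euclidean ball. All quotients, suprema and limits are taken in `[0, ∞]`. -/
def volumeExponents {d : ℕ} (P : Measure (EuclideanSpace ℝ (Fin d)))
    (𝕏 : Set (EuclideanSpace ℝ (Fin d))) : Set ℝ :=
  {ν : ℝ | 0 ≤ ν ∧
    limsup (fun r : ℝ => ⨆ x ∈ 𝕏, P (Metric.ball x r) / ENNReal.ofReal (r ^ ν)) (𝓝[>] 0) < ∞}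

/-- The volume dimension of `P` (relative to `𝕏`), as a non-negative real number. When it is
positive it is a genuine supremum, see `isLUB_volumeDimension`. -/
def volumeDimension {d : ℕ} (P : Measure (EuclideanSpace ℝ (Fin d)))
    (𝕏 : Set (EuclideanSpace ℝ (Fin d))) : ℝ :=
  sSup (volumeExponents P 𝕏)

/-- If `sSup` were taken of an empty or an unbounded set, it would be `0`. -/
theorem isLUB_volumeDimension {d : ℕ} {P : Measure (EuclideanSpace ℝ (Fin d))}
    {𝕏 : Set (EuclideanSpace ℝ (Fin d))} (h : 0 < volumeDimension P 𝕏) :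
    IsLUB (volumeExponents P 𝕏) (volumeDimension P 𝕏) := by
  unfold volumeDimension at h ⊢
  refine Real.isLUB_sSup ?_ ?_
  · by_contra hne
    rw [Set.not_nonempty_iff_eq_empty] at hne
    simp [hne] at h
  · by_contra hb
    rw [Real.sSup_of_not_bddAbove hb] at h
    exact lt_irrefl _ h

/-- `sup_{x ∈ 𝕏} liminf_{r → 0} P(B(x, r)) / r ^ d_vol > 0`. -/
def VolumeDimensionExactLower {d : ℕ} (P : Measure (EuclideanSpace ℝ (Fin d)))
    (𝕏 : Set (EuclideanSpace ℝ (Fin d))) : Prop :=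
  0 < ⨆ x ∈ 𝕏, liminf (fun r : ℝ =>
    P (Metric.ball x r) / ENNReal.ofReal (r ^ volumeDimension P 𝕏)) (𝓝[>] 0)

/-- The kernel `K` is bounded, and either `d_vol = 0` or
`∫_0^∞ t ^ (d_vol - 1) sup_{‖x‖ ≥ t} |K x| ^ k dt < ∞`. -/
def KernelIntegrability {d : ℕ} (P : Measure (EuclideanSpace ℝ (Fin d)))
    (𝕏 : Set (EuclideanSpace ℝ (Fin d))) (K : EuclideanSpace ℝ (Fin d) → ℝ) (k : ℝ) : Prop :=
  (∃ M : ℝ, ∀ x, |K x| ≤ M) ∧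
    (volumeDimension P 𝕏 = 0 ∨
      ∫⁻ t in Ioi (0 : ℝ), ENNReal.ofReal (t ^ (volumeDimension P 𝕏 - 1)) *
        (⨆ x : EuclideanSpace ℝ (Fin d), ⨆ _ : t ≤ ‖x‖, ENNReal.ofReal (|K x| ^ k)) < ∞)

/-- The kernel density estimator
`x ↦ (1 / (n h ^ d)) ∑ i, K ((x - X i) / h)` of the sample points `X 0, …, X (n - 1)`. -/
def kde {d n : ℕ} (K : EuclideanSpace ℝ (Fin d) → ℝ) (h : ℝ)
    (X : Fin n → EuclideanSpace ℝ (Fin d)) (x : EuclideanSpace ℝ (Fin d)) : ℝ :=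
  1 / ((n : ℝ) * h ^ d) * ∑ i, K (h⁻¹ • (x - X i))

/-- The pointwise expectation `x ↦ 𝔼[kde K h X x]` of the kernel density estimator of a random
sample `X 0, …, X (n - 1)`. -/
def kdeMean {d n : ℕ} {Ω : Type*} [MeasurableSpace Ω] (μ : Measure Ω)
    (K : EuclideanSpace ℝ (Fin d) → ℝ) (h : ℝ)
    (X : Fin n → Ω → EuclideanSpace ℝ (Fin d)) (x : EuclideanSpace ℝ (Fin d)) : ℝ :=
  ∫ ω, kde K h (fun i => X i ω) x ∂μ

/-- `sup_{h ≥ l, x ∈ 𝕏} |kde K h X x - 𝔼[kde K h X x]|` at the outcome `ω`, in `[0, ∞]`. -/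
def kdeRayDeviation {d n : ℕ} {Ω : Type*} [MeasurableSpace Ω] (μ : Measure Ω)
    (𝕏 : Set (EuclideanSpace ℝ (Fin d))) (K : EuclideanSpace ℝ (Fin d) → ℝ) (l : ℝ)
    (X : Fin n → Ω → EuclideanSpace ℝ (Fin d)) (ω : Ω) : ℝ≥0∞ :=
  ⨆ h : ℝ, ⨆ _ : l ≤ h, ⨆ x ∈ 𝕏,
    ENNReal.ofReal |kde K h (fun i => X i ω) x - kdeMean μ K h X x|

end

/-! A single point and the single bandwidth `h = l n` already force the deviation. Take `x ∈ 𝕏`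
where balls have mass at least `p * r ^ v`, with `v` the volume dimension. The sum of `K ((x - X i)
/ l)` has i.i.d. bounded terms, each at least `c / 2` with probability of order `l ^ v` (sample
point near `x`) and at most `c / 4` with probability at least `1 / 2` (sample point far from `x`).
So the sum should spread over a scale `√(n * l ^ v)`, and dividing by `n * l ^ d` gives the claimed
rate.

The spread is quantified by `measureReal_abs_sum_sub_le_of_iIndepFun`, an Esseen-type
anti-concentration bound: two separated values make the characteristic function decay like a
Gaussian near `0`, which bounds the mass of every short interval, wherever it is centred. -/

/-! ### Anti-concentration from characteristic functions -/

/-- The Gaussian weight is the average of `exp (i t (x - m))` over `t ∼ N(0, v)`. After Fubini, the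
shift by `m` is only a phase of modulus one. -/
theorem integral_exp_neg_sq_le_integral_norm_charFun (σ : Measure ℝ) [IsProbabilityMeasure σ]
    (m : ℝ) (v : NNReal) :
    ∫ x, Real.exp (-(v * (x - m) ^ 2 / 2)) ∂σ ≤ ∫ t, ‖charFun σ t‖ ∂gaussianReal 0 v := by
  have hswap : ∫ x, ∫ t, Complex.exp (t * (x - m : ℝ) * Complex.I) ∂gaussianReal 0 v ∂σ =
      ∫ t, ∫ x, Complex.exp (t * (x - m : ℝ) * Complex.I) ∂σ ∂gaussianReal 0 v := by
    refine integral_integral_swap (Integrable.of_bound (C := 1) ?_ ?_)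
    · exact (by fun_prop : Measurable _).aestronglyMeasurable
    · refine ae_of_all _ fun p => ?_
      simp only [Function.uncurry]
      rw [← Complex.ofReal_mul, Complex.norm_exp_ofReal_mul_I]
  have hleft : ∀ x : ℝ, ∫ t, Complex.exp (t * (x - m : ℝ) * Complex.I) ∂gaussianReal 0 v =
      (Real.exp (-(v * (x - m) ^ 2 / 2)) : ℝ) := by
    intro x
    have h := charFun_gaussianReal (μ := 0) (v := v) (x - m)
    rw [charFun_apply_real] at h
    simp only [mul_comm ((x - m : ℝ) : ℂ)] at h
    rw [h]
    push_cast
    simp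
  have hright : ∀ t : ℝ, ‖∫ x, Complex.exp (t * (x - m : ℝ) * Complex.I) ∂σ‖ =
      ‖charFun σ t‖ := by
    intro t
    have h : ∀ x : ℝ, Complex.exp (t * (x - m : ℝ) * Complex.I) =
        Complex.exp ((-(t * m) : ℝ) * Complex.I) * Complex.exp (t * x * Complex.I) := by
      intro x
      rw [← Complex.exp_add]
      congr 1
      push_cast
      ring
    simp_rw [h]
    rw [integral_const_mul, norm_mul, Complex.norm_exp_ofReal_mul_I, one_mul, charFun_apply_real]
  simp_rw [hleft] at hswap
  rw [integral_complex_ofReal] at hswap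
  calc ∫ x, Real.exp (-(v * (x - m) ^ 2 / 2)) ∂σ
      ≤ ‖((∫ x, Real.exp (-(v * (x - m) ^ 2 / 2)) ∂σ : ℝ) : ℂ)‖ := by
        rw [Complex.norm_real]; exact le_abs_self _
    _ ≤ ∫ t, ‖∫ x, Complex.exp (t * (x - m : ℝ) * Complex.I) ∂σ‖ ∂gaussianReal 0 v := by
        rw [hswap]; exact norm_integral_le_integral_norm _
    _ = _ := by simp_rw [hright]

theorem integral_exp_neg_mul_sq_gaussianReal_le {v : NNReal} (hv : v ≠ 0) {β : ℝ} (hβ : 0 < β) :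
    ∫ t, Real.exp (-β * t ^ 2) ∂gaussianReal 0 v ≤ (√(2 * v * β))⁻¹ := by
  rw [integral_gaussianReal_eq_integral_smul hv]
  have hint := integrable_exp_neg_mul_sq hβ
  have hle : ∀ t, gaussianPDFReal 0 v t • Real.exp (-β * t ^ 2) ≤
      (√(2 * Real.pi * v))⁻¹ * Real.exp (-β * t ^ 2) := by
    intro t
    rw [smul_eq_mul, gaussianPDFReal]
    gcongr
    refine mul_le_of_le_one_right (by positivity) ?_
    rw [Real.exp_le_one_iff]
    exact div_nonpos_of_nonpos_of_nonneg (by nlinarith [sq_nonneg (t - 0)]) (by positivity)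
  calc _ ≤ ∫ t, (√(2 * Real.pi * v))⁻¹ * Real.exp (-β * t ^ 2) :=
        integral_mono_of_nonneg
          (ae_of_all _ fun t => smul_nonneg (gaussianPDFReal_nonneg _ _ _) (Real.exp_nonneg _))
          (hint.const_mul _) (ae_of_all _ hle)
    _ = (√(2 * v * β))⁻¹ := by
        rw [integral_const_mul, integral_gaussian, ← Real.sqrt_inv, ← Real.sqrt_inv,
          ← Real.sqrt_mul (by positivity)]
        congr 1
        have := Real.pi_pos
        field_simp

theorem measureReal_abs_sub_le_of_norm_charFun_le (σ : Measure ℝ) [IsProbabilityMeasure σ]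
    {β T L : ℝ} (m : ℝ) (hβ : 0 < β) (hT : 0 < T) (hL : 0 < L)
    (h : ∀ t, |t| ≤ T → ‖charFun σ t‖ ≤ Real.exp (-β * t ^ 2)) :
    σ.real {x | |x - m| ≤ L} ≤ Real.exp (1 / 2) * (L / √(2 * β) + 1 / (L * T) ^ 2) := by
  -- With this variance the Gaussian weight is at least `exp (-1/2)` on the window of radius `L`.
  obtain ⟨v, hv⟩ : ∃ v : NNReal, (v : ℝ) = 1 / L ^ 2 := ⟨⟨1 / L ^ 2, by positivity⟩, rfl⟩
  have hv0 : v ≠ 0 := by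
    rw [← NNReal.coe_ne_zero, hv]; positivity
  have hmarkov : Real.exp (-(1 / 2)) * σ.real {x | |x - m| ≤ L} ≤
      ∫ x, Real.exp (-(v * (x - m) ^ 2 / 2)) ∂σ := by
    have hint : Integrable (fun x => Real.exp (-(v * (x - m) ^ 2 / 2))) σ := by
      refine Integrable.of_bound (C := 1) (by fun_prop) (ae_of_all _ fun x => ?_)
      rw [Real.norm_of_nonneg (Real.exp_nonneg _), Real.exp_le_one_iff, neg_nonpos]
      positivity
    refine le_trans ?_ (mul_meas_ge_le_integral_of_nonneg
      (ae_of_all _ fun x => Real.exp_nonneg _) hint (Real.exp (-(1 / 2))))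
    refine mul_le_mul_of_nonneg_left (measureReal_mono fun x hx => ?_) (Real.exp_nonneg _)
    simp only [mem_ofPred_eq, Real.exp_le_exp, neg_le_neg_iff] at hx ⊢
    rw [hv, div_mul_eq_mul_div, one_mul, div_le_div_iff_of_pos_right two_pos,
      div_le_one (by positivity)]
    exact sq_le_sq' (abs_le.1 hx).1 (abs_le.1 hx).2
  have hsq : Integrable (fun t : ℝ => t ^ 2) (gaussianReal 0 v) :=
    (memLp_id_gaussianReal' (μ := 0) (v := v) 2 (by simp)).integrable_sq
  have hexp : Integrable (fun t : ℝ => Real.exp (-β * t ^ 2)) (gaussianReal 0 v) := by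
    refine Integrable.of_bound (C := 1) (by fun_prop) (ae_of_all _ fun x => ?_)
    rw [Real.norm_of_nonneg (Real.exp_nonneg _), Real.exp_le_one_iff]
    nlinarith [sq_nonneg x]
  have hvar : ∫ t, t ^ 2 ∂gaussianReal 0 v = v := by
    have := variance_fun_id_gaussianReal (μ := 0) (v := v)
    rwa [variance_of_integral_eq_zero (by fun_prop) (by simp)] at this
  -- Frequencies beyond `T` are paid for in Chebyshev's manner: there `1 ≤ t ^ 2 / T ^ 2`.
  have hpt : ∀ t : ℝ, ‖charFun σ t‖ ≤ Real.exp (-β * t ^ 2) + (1 / T ^ 2) * t ^ 2 := by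
    intro t
    rcases le_or_gt |t| T with ht | ht
    · exact (h t ht).trans (le_add_of_nonneg_right (by positivity))
    · refine (norm_charFun_le_one t).trans
        (le_trans ?_ (le_add_of_nonneg_left (Real.exp_nonneg _)))
      rw [one_div_mul_eq_div, one_le_div (by positivity), ← sq_abs t]
      gcongr
  have hbound : ∫ t, ‖charFun σ t‖ ∂gaussianReal 0 v ≤ L / √(2 * β) + 1 / (L * T) ^ 2 := by
    calc _ ≤ ∫ t, (Real.exp (-β * t ^ 2) + (1 / T ^ 2) * t ^ 2) ∂gaussianReal 0 v :=
          integral_mono_of_nonneg (ae_of_all _ fun _ => norm_nonneg _)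
            (hexp.add (hsq.const_mul _)) (ae_of_all _ hpt)
      _ = (∫ t, Real.exp (-β * t ^ 2) ∂gaussianReal 0 v) + (1 / T ^ 2) * v := by
          rw [integral_add hexp (hsq.const_mul _), integral_const_mul, hvar]
      _ ≤ (√(2 * v * β))⁻¹ + (1 / T ^ 2) * v := by
          gcongr; exact integral_exp_neg_mul_sq_gaussianReal_le hv0 hβ
      _ = L / √(2 * β) + 1 / (L * T) ^ 2 := by
          rw [hv]
          have : 2 * (1 / L ^ 2) * β = 2 * β / L ^ 2 := by ring
          rw [this, Real.sqrt_div' _ (by positivity), Real.sqrt_sq hL.le, inv_div]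
          congr 1
          field_simp
  have := hmarkov.trans ((integral_exp_neg_sq_le_integral_norm_charFun σ m v).trans hbound)
  rw [Real.exp_neg] at this
  rwa [inv_mul_le_iff₀ (Real.exp_pos _)] at this

theorem norm_charFun_sq_eq_integral_cos (ν : Measure ℝ) [IsProbabilityMeasure ν] (t : ℝ) :
    ‖charFun ν t‖ ^ 2 = ∫ p : ℝ × ℝ, Real.cos (t * (p.1 - p.2)) ∂ν.prod ν := by
  have hint : Integrable (fun p : ℝ × ℝ => Complex.exp ((t * (p.1 - p.2) : ℝ) * Complex.I))
      (ν.prod ν) := by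
    refine Integrable.of_bound (C := 1) (by fun_prop) (ae_of_all _ fun p => ?_)
    rw [Complex.norm_exp_ofReal_mul_I]
  have h : ((‖charFun ν t‖ ^ 2 : ℝ) : ℂ) =
      ∫ p : ℝ × ℝ, Complex.exp ((t * (p.1 - p.2) : ℝ) * Complex.I) ∂ν.prod ν := by
    rw [Complex.ofReal_pow, ← Complex.mul_conj', ← charFun_neg, charFun_apply_real,
      charFun_apply_real, ← integral_prod_mul]
    congr with p
    rw [← Complex.exp_add]
    congr 1
    push_cast
    ring
  have h' := congrArg Complex.re h
  rw [Complex.ofReal_re] at h'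
  rw [h', ← RCLike.re_eq_complex_re, ← integral_re hint]
  simp only [RCLike.re_eq_complex_re, Complex.exp_ofReal_mul_I_re]

/-- Symmetrization: the square is the mean of `cos (t (Y - Y'))` for independent copies. Use `cos u
≤ 1 - 2 u² / π²` for `|u| ≤ π` where `Y ≥ a` and `Y' ≤ b`, and `cos ≤ 1` elsewhere. -/
theorem norm_charFun_sq_le_of_bounded (ν : Measure ℝ) [IsProbabilityMeasure ν] {M a b t : ℝ}
    (hM : ∀ᵐ y ∂ν, |y| ≤ M) (hba : b ≤ a) (ht : |t| * (2 * M) ≤ Real.pi) :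
    ‖charFun ν t‖ ^ 2 ≤
      1 - 2 / Real.pi ^ 2 * (a - b) ^ 2 * (ν.real (Ici a) * ν.real (Iic b)) * t ^ 2 := by
  rw [norm_charFun_sq_eq_integral_cos]
  set c : ℝ := 2 / Real.pi ^ 2 * (a - b) ^ 2 * t ^ 2 with hc
  have hmeas : MeasurableSet (Ici a ×ˢ Iic b) := measurableSet_Ici.prod measurableSet_Iic
  have hint : Integrable (fun p : ℝ × ℝ => 1 - (Ici a ×ˢ Iic b).indicator (fun _ => c) p)
      (ν.prod ν) := (integrable_const _).sub ((integrable_const _).indicator hmeas)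
  have hcos : Integrable (fun p : ℝ × ℝ => Real.cos (t * (p.1 - p.2))) (ν.prod ν) :=
    Integrable.of_bound (C := 1) (by fun_prop) (ae_of_all _ fun p => Real.abs_cos_le_one _)
  have hle : ∀ᵐ p ∂ν.prod ν, Real.cos (t * (p.1 - p.2)) ≤
      1 - (Ici a ×ˢ Iic b).indicator (fun _ => c) p := by
    filter_upwards [Measure.quasiMeasurePreserving_fst.ae hM,
      Measure.quasiMeasurePreserving_snd.ae hM] with p hp1 hp2
    by_cases hp : p ∈ Ici a ×ˢ Iic b
    · rw [indicator_of_mem hp]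
      obtain ⟨h1, h2⟩ := hp
      rw [mem_Ici] at h1
      rw [mem_Iic] at h2
      have habs : |t * (p.1 - p.2)| ≤ Real.pi := by
        rw [abs_mul]
        refine le_trans ?_ ht
        gcongr
        exact (abs_sub _ _).trans (by linarith)
      refine (Real.cos_le_one_sub_mul_cos_sq habs).trans ?_
      have : (a - b) ^ 2 ≤ (p.1 - p.2) ^ 2 := by
        apply pow_le_pow_left₀ <;> linarith
      rw [hc, mul_pow, mul_assoc (2 / Real.pi ^ 2), mul_comm (t ^ 2)]
      gcongr
    · rw [indicator_of_notMem hp, sub_zero]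
      exact Real.cos_le_one _
  calc _ ≤ ∫ p, (1 - (Ici a ×ˢ Iic b).indicator (fun _ => c) p) ∂ν.prod ν :=
        integral_mono_ae hcos hint hle
    _ = _ := by
        rw [integral_sub (integrable_const _) ((integrable_const _).indicator hmeas),
          integral_indicator_const _ hmeas, measureReal_prod_prod]
        simp only [integral_const, probReal_univ, smul_eq_mul, one_mul, hc]
        ring

theorem measureReal_abs_sum_sub_le_of_iIndepFun {Ω : Type*} [MeasurableSpace Ω] {μ : Measure Ω}
    [IsProbabilityMeasure μ] {n : ℕ} {Y : Fin n → Ω → ℝ} (hY : ∀ i, Measurable (Y i))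
    (hindep : iIndepFun Y μ) {ν : Measure ℝ} [IsProbabilityMeasure ν]
    (hlaw : ∀ i, μ.map (Y i) = ν)
    {M a b L : ℝ} (m : ℝ) (hM0 : 0 < M) (hM : ∀ᵐ y ∂ν, |y| ≤ M) (hba : b < a) (hL : 0 < L)
    (hn : 0 < n) (ha : 0 < ν.real (Ici a)) (hb : 0 < ν.real (Iic b)) :
    μ.real {ω | |∑ i, Y i ω - m| ≤ L} ≤ Real.exp (1 / 2) *
      (L * Real.pi / ((a - b) * √(2 * n * (ν.real (Ici a) * ν.real (Iic b)))) +
        (2 * M / (L * Real.pi)) ^ 2) := by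
  have hpi := Real.pi_pos
  have hab : 0 < a - b := sub_pos.2 hba
  have hS : Measurable fun ω => ∑ i, Y i ω := Finset.measurable_sum _ fun i _ => hY i
  set κ : ℝ := (a - b) ^ 2 * (ν.real (Ici a) * ν.real (Iic b)) / Real.pi ^ 2 with hκ
  have hκ0 : 0 < κ := by positivity
  have : IsProbabilityMeasure (μ.map fun ω => ∑ i, Y i ω) :=
    Measure.isProbabilityMeasure_map hS.aemeasurable
  have hchar : ∀ t, |t| ≤ Real.pi / (2 * M) →
      ‖charFun (μ.map fun ω => ∑ i, Y i ω) t‖ ≤ Real.exp (-(n * κ) * t ^ 2) := by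
    intro t ht
    have h1 : ‖charFun ν t‖ ≤ Real.exp (-κ * t ^ 2) := by
      refine (sq_le_sq₀ (norm_nonneg _) (Real.exp_nonneg _)).1 ?_
      refine (norm_charFun_sq_le_of_bounded ν hM hba.le
        ((le_div_iff₀ (by positivity)).1 ht)).trans ?_
      rw [← Real.exp_nat_mul]
      refine le_trans (le_of_eq ?_) (Real.add_one_le_exp _)
      rw [hκ]
      push_cast
      ring
    rw [hindep.charFun_map_fun_sum_eq_prod fun i => (hY i).aemeasurable]
    simp only [hlaw, Finset.prod_const, Finset.card_univ, Fintype.card_fin, Pi.pow_apply, norm_pow]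
    calc _ ≤ Real.exp (-κ * t ^ 2) ^ n := by gcongr
      _ = _ := by rw [← Real.exp_nat_mul]; congr 1; ring
  have hmain := measureReal_abs_sub_le_of_norm_charFun_le _ m (by positivity) (by positivity) hL
    hchar
  rw [map_measureReal_apply hS (measurableSet_le (by fun_prop) (by fun_prop))] at hmain
  refine hmain.trans (le_of_eq ?_)
  congr 2
  · have : 2 * (n * κ) =
        ((a - b) / Real.pi) ^ 2 * (2 * n * (ν.real (Ici a) * ν.real (Iic b))) := by
      rw [hκ]; ring
    rw [this, Real.sqrt_mul (by positivity), Real.sqrt_sq (by positivity)]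
    field_simp
  · field_simp

/-! ### Consequences of the volume dimension and kernel hypotheses -/

theorem VolumeDimensionExactLower.exists_le_measureReal_ball {d : ℕ}
    {P : Measure (EuclideanSpace ℝ (Fin d))} [IsProbabilityMeasure P]
    {𝕏 : Set (EuclideanSpace ℝ (Fin d))} (h : VolumeDimensionExactLower P 𝕏) :
    ∃ x ∈ 𝕏, ∃ p : ℝ, 0 < p ∧
      ∀ᶠ r in 𝓝[>] (0 : ℝ), p * r ^ volumeDimension P 𝕏 ≤ P.real (Metric.ball x r) := by
  unfold VolumeDimensionExactLower at h
  simp only [lt_iSup_iff] at h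
  obtain ⟨x, hx, h⟩ := h
  obtain ⟨p, hp0, hp⟩ := ENNReal.lt_iff_exists_nnreal_btwn.1 h
  refine ⟨x, hx, p, by exact_mod_cast hp0, ?_⟩
  filter_upwards [eventually_lt_of_lt_liminf hp, self_mem_nhdsWithin] with r hr hr0
  have hpow : 0 < r ^ volumeDimension P 𝕏 := Real.rpow_pos_of_pos hr0 _
  have h1 := (ENNReal.le_div_iff_mul_le (Or.inl (ENNReal.ofReal_pos.2 hpow).ne')
    (Or.inl ENNReal.ofReal_ne_top)).1 hr.le
  have h2 := ENNReal.toReal_mono (measure_ne_top _ _) h1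
  rwa [ENNReal.toReal_mul, ENNReal.toReal_ofReal hpow.le] at h2

theorem tendsto_measureReal_ball_of_volumeDimension_pos {d : ℕ}
    {P : Measure (EuclideanSpace ℝ (Fin d))}
    {𝕏 : Set (EuclideanSpace ℝ (Fin d))} (h : 0 < volumeDimension P 𝕏)
    {x : EuclideanSpace ℝ (Fin d)} (hx : x ∈ 𝕏) :
    Tendsto (fun r => P.real (Metric.ball x r)) (𝓝[>] 0) (𝓝 0) := by
  obtain ⟨ν, ⟨-, hν⟩, hν0⟩ := (lt_isLUB_iff (isLUB_volumeDimension h)).1 h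
  obtain ⟨B, hB, hBtop⟩ := exists_between hν
  have hev := eventually_lt_of_limsup_lt hB
  have hpow : Tendsto (fun r : ℝ => r ^ ν) (𝓝[>] 0) (𝓝 0) := by
    have := (Real.continuousAt_rpow_const 0 ν (Or.inr hν0.le)).tendsto
    rw [Real.zero_rpow hν0.ne'] at this
    exact this.mono_left nhdsWithin_le_nhds
  refine squeeze_zero' (Eventually.of_forall fun _ => measureReal_nonneg) ?_
    (by simpa using hpow.const_mul B.toReal)
  filter_upwards [hev, self_mem_nhdsWithin] with r hr hr0
  have hrν : 0 < r ^ ν := Real.rpow_pos_of_pos hr0 _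
  have h1 : P (Metric.ball x r) / ENNReal.ofReal (r ^ ν) ≤ B :=
    (le_iSup₂ (f := fun x (_ : x ∈ 𝕏) => P (Metric.ball x r) / ENNReal.ofReal (r ^ ν)) x hx).trans
      hr.le
  have h2 := (ENNReal.div_le_iff_le_mul (Or.inl (ENNReal.ofReal_pos.2 hrν).ne')
    (Or.inl ENNReal.ofReal_ne_top)).1 h1
  have h3 := ENNReal.toReal_mono (ENNReal.mul_ne_top hBtop.ne ENNReal.ofReal_ne_top) h2
  rwa [ENNReal.toReal_mul, ENNReal.toReal_ofReal hrν.le] at h3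

/-- Otherwise the tail supremum stays at least `ε` for all `t > 0`, and `t ^ (v - 1)` would be
integrable on `(0, ∞)`, which no power of `t` is. -/
theorem KernelIntegrability.exists_forall_le_norm_abs_le {d : ℕ}
    {P : Measure (EuclideanSpace ℝ (Fin d))} {𝕏 : Set (EuclideanSpace ℝ (Fin d))}
    {K : EuclideanSpace ℝ (Fin d) → ℝ} (hK : KernelIntegrability P 𝕏 K 1)
    (hd : 0 < volumeDimension P 𝕏) {ε : ℝ} (hε : 0 < ε) :
    ∃ R : ℝ, 0 < R ∧ ∀ x, R ≤ ‖x‖ → |K x| ≤ ε := by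
  by_contra! hcon
  have hfin := hK.2.resolve_left hd.ne'
  set v := volumeDimension P 𝕏
  have hle : ∫⁻ t in Ioi (0 : ℝ), ENNReal.ofReal (t ^ (v - 1)) * ENNReal.ofReal ε < ∞ := by
    refine lt_of_le_of_lt (setLIntegral_mono' measurableSet_Ioi fun t ht => ?_) hfin
    obtain ⟨x, hx, hKx⟩ := hcon t ht
    gcongr
    refine le_iSup₂_of_le x hx (ENNReal.ofReal_le_ofReal ?_)
    rw [Real.rpow_one]
    exact hKx.le
  rw [lintegral_mul_const' _ _ ENNReal.ofReal_ne_top] at hle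
  have hlt : ∫⁻ t in Ioi (0 : ℝ), ENNReal.ofReal (t ^ (v - 1)) < ∞ :=
    ENNReal.lt_top_of_mul_ne_top_left hle.ne (ENNReal.ofReal_pos.2 hε).ne'
  refine not_integrableOn_Ioi_rpow (v - 1) ⟨?_, ?_⟩
  · exact (by fun_prop : Measurable fun t : ℝ => t ^ (v - 1)).aestronglyMeasurable
  · rw [hasFiniteIntegral_iff_ofReal]
    · exact hlt
    · exact (ae_restrict_mem measurableSet_Ioi).mono fun t ht => Real.rpow_nonneg (le_of_lt ht) _

theorem exists_forall_norm_le_of_tendsto_iInf_closedBall {E : Type*} [SeminormedAddCommGroup E]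
    {K : E → ℝ} (hbdd : BddBelow (range K)) {c a : ℝ} (hac : a < c)
    (h : Tendsto (fun t : ℝ => ⨅ x : Metric.closedBall (0 : E) t, K x) (𝓝[>] 0) (𝓝 c)) :
    ∃ t : ℝ, 0 < t ∧ ∀ x, ‖x‖ ≤ t → a ≤ K x := by
  obtain ⟨t, ht, ht0⟩ := ((h.eventually_const_lt hac).and self_mem_nhdsWithin).exists
  refine ⟨t, ht0, fun x hx => ht.le.trans ?_⟩
  exact ciInf_le (hbdd.mono (range_comp_subset_range Subtype.val K))
    (⟨x, by simpa using hx⟩ : Metric.closedBall (0 : E) t)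

theorem sqrt_one_div_mul_rpow_sub {n l v : ℝ} (d : ℕ) (hn : 0 < n) (hl : 0 < l) :
    √(1 / (n * l ^ (2 * (d : ℝ) - v))) = 1 / (n * l ^ d) * √(n * l ^ v) := by
  have h : 1 / (n * l ^ (2 * (d : ℝ) - v)) = (1 / (n * l ^ d)) ^ 2 * (n * l ^ v) := by
    have hv := Real.rpow_pos_of_pos hl v
    rw [Real.rpow_sub hl, mul_comm (2 : ℝ), Real.rpow_mul hl.le, Real.rpow_natCast, Real.rpow_two]
    field_simp
  rw [h, Real.sqrt_mul (by positivity), Real.sqrt_sq (by positivity)]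

theorem ofReal_le_kdeRayDeviation {d n : ℕ} {Ω : Type*} [MeasurableSpace Ω] {μ : Measure Ω}
    {𝕏 : Set (EuclideanSpace ℝ (Fin d))} {K : EuclideanSpace ℝ (Fin d) → ℝ} {l : ℝ}
    {X : Fin n → Ω → EuclideanSpace ℝ (Fin d)} {x : EuclideanSpace ℝ (Fin d)} (hx : x ∈ 𝕏)
    {ω : Ω} {ε : ℝ} (hε : 0 ≤ 1 / ((n : ℝ) * l ^ d))
    (h : ε ≤ |∑ i, K (l⁻¹ • (x - X i ω)) - ∫ ω, ∑ i, K (l⁻¹ • (x - X i ω)) ∂μ|) :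
    ENNReal.ofReal (1 / ((n : ℝ) * l ^ d) * ε) ≤ kdeRayDeviation μ 𝕏 K l X ω := by
  unfold kdeRayDeviation
  refine le_iSup₂_of_le l le_rfl (le_iSup₂_of_le x hx (ENNReal.ofReal_le_ofReal ?_))
  simp only [kdeMean, kde, integral_const_mul]
  rw [← mul_sub, abs_mul, abs_of_nonneg hε]
  gcongr

/-! ### The lower bound -/

theorem mainTheorem5 {d : ℕ} (P : Measure (EuclideanSpace ℝ (Fin d))) [IsProbabilityMeasure P]
    (𝕏 : Set (EuclideanSpace ℝ (Fin d)))
    (hdvol : 0 < volumeDimension P 𝕏)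
    (hlower : VolumeDimensionExactLower P 𝕏)
    (K : EuclideanSpace ℝ (Fin d) → ℝ) (hKmeas : Measurable K)
    (hKint : KernelIntegrability P 𝕏 K 1)
    (hKpos : ∃ c : ℝ, 0 < c ∧
      Tendsto (fun t : ℝ => ⨅ x : Metric.closedBall (0 : EuclideanSpace ℝ (Fin d)) t, K x)
        (𝓝[>] 0) (𝓝 c))
    (δ : ℝ) (hδ0 : 0 < δ) (hδ1 : δ < 1) :
    ∃ C : ℝ, 0 < C ∧
      ∀ l : ℕ → ℝ, (∀ n, 0 < l n) → Tendsto l atTop (𝓝 0) →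
        Tendsto (fun n : ℕ => (n : ℝ) * l n ^ volumeDimension P 𝕏) atTop atTop →
        ∀ᶠ n : ℕ in atTop,
          ∀ (Ω : Type*) [MeasurableSpace Ω] (μ : Measure Ω) [IsProbabilityMeasure μ]
            (X : Fin n → Ω → EuclideanSpace ℝ (Fin d)),
            (∀ i, Measurable (X i)) → iIndepFun X μ → (∀ i, μ.map (X i) = P) →
            ∃ A : Set Ω, MeasurableSet A ∧ ENNReal.ofReal (1 - δ) ≤ μ A ∧
              ∀ ω ∈ A,
                ENNReal.ofReal
                    (C * √(1 / ((n : ℝ) * l n ^ (2 * (d : ℝ) - volumeDimension P 𝕏)))) ≤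
                  kdeRayDeviation μ 𝕏 K (l n) X ω := by
  obtain ⟨c, hc0, hc⟩ := hKpos
  obtain ⟨M, hM⟩ := hKint.1
  have hM1 : ∀ x, |K x| ≤ |M| + 1 := fun x => (hM x).trans (by linarith [le_abs_self M])
  have hbdd : BddBelow (range K) := ⟨-M, by rintro _ ⟨x, rfl⟩; exact (abs_le.1 (hM x)).1⟩
  obtain ⟨t₀, ht₀, hnear⟩ :=
    exists_forall_norm_le_of_tendsto_iInf_closedBall hbdd (half_lt_self hc0) hc
  obtain ⟨R, hR, hfar⟩ := hKint.exists_forall_le_norm_abs_le hdvol (ε := c / 4) (by positivity)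
  obtain ⟨x, hx, p, hp, hball⟩ := hlower.exists_le_measureReal_ball
  have hball0 := tendsto_measureReal_ball_of_volumeDimension_pos hdvol hx
  set v := volumeDimension P 𝕏 with hv
  have hpi := Real.pi_pos
  set s₀ : ℝ := √(p * t₀ ^ v) with hs₀
  have hs₀pos : 0 < s₀ := Real.sqrt_pos.2 (mul_pos hp (Real.rpow_pos_of_pos ht₀ _))
  -- Chosen so that the main term of the anti-concentration bound, with gap `c / 2 - c / 4`, is at
  -- most `δ / 2`.
  set C : ℝ := δ * c * s₀ / (8 * Real.pi * Real.exp (1 / 2)) with hC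
  have hC0 : 0 < C := by positivity
  refine ⟨C, hC0, fun l hl hl0 hnl => ?_⟩
  have hscale : ∀ s : ℝ, 0 < s → Tendsto (fun n => s * l n) atTop (𝓝[>] 0) := fun s hs =>
    tendsto_nhdsWithin_iff.2
      ⟨by simpa using hl0.const_mul s, Eventually.of_forall fun n => mul_pos hs (hl n)⟩
  -- The high-frequency remainder; it vanishes because `n * l n ^ v → ∞`, leaving the other `δ / 2`.
  have hsmall : Tendsto (fun n : ℕ => Real.exp (1 / 2) *
      ((2 * (|M| + 1) / (C * Real.pi)) ^ 2 / (n * l n ^ v))) atTop (𝓝 0) := by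
    simpa using (hnl.const_div_atTop _).const_mul (Real.exp (1 / 2))
  filter_upwards [(hscale t₀ ht₀).eventually hball,
    ((hball0.comp (hscale R hR)).eventually_lt_const (half_pos one_pos)),
    hsmall.eventually_lt_const (half_pos hδ0), eventually_gt_atTop 0]
    with n hlow hup hrem hn Ω _ μ _ X hX hindep hlaw
  have hn' : (0 : ℝ) < n := Nat.cast_pos.2 hn
  have hln := hl n
  have hlv : 0 < l n ^ v := Real.rpow_pos_of_pos hln v
  have hf : Measurable fun y => K ((l n)⁻¹ • (x - y)) := by fun_prop
  have hY : ∀ i, Measurable fun ω => K ((l n)⁻¹ • (x - X i ω)) := fun i => hf.comp (hX i)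
  have hYindep : iIndepFun (fun i ω => K ((l n)⁻¹ • (x - X i ω))) μ :=
    hindep.comp (fun _ y => K ((l n)⁻¹ • (x - y))) fun _ => hf
  have hYlaw : ∀ i, μ.map (fun ω => K ((l n)⁻¹ • (x - X i ω))) =
      P.map fun y => K ((l n)⁻¹ • (x - y)) := fun i => by
    rw [← hlaw i, Measure.map_map hf (hX i)]; rfl
  have hν : IsProbabilityMeasure (P.map fun y => K ((l n)⁻¹ • (x - y))) :=
    Measure.isProbabilityMeasure_map hf.aemeasurable
  have hnorm : ∀ y, ‖(l n)⁻¹ • (x - y)‖ = dist y x / l n := fun y => by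
    rw [norm_smul, norm_inv, Real.norm_of_nonneg hln.le, dist_comm, dist_eq_norm,
      inv_mul_eq_div]
  have hq : p * t₀ ^ v * l n ^ v ≤
      (P.map fun y => K ((l n)⁻¹ • (x - y))).real (Ici (c / 2)) := by
    rw [map_measureReal_apply hf measurableSet_Ici, mul_assoc,
      ← Real.mul_rpow ht₀.le hln.le]
    refine hlow.trans (measureReal_mono fun y hy => hnear _ ?_)
    rw [hnorm, div_le_iff₀ hln]
    exact (Metric.mem_ball.1 hy).le
  have hr : 1 / 2 ≤ (P.map fun y => K ((l n)⁻¹ • (x - y))).real (Iic (c / 4)) := by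
    rw [map_measureReal_apply hf measurableSet_Iic]
    have h1 := probReal_compl_eq_one_sub (μ := P) (Metric.isOpen_ball (x := x)
      (ε := R * l n)).measurableSet
    have h2 : (Metric.ball x (R * l n))ᶜ ⊆ (fun y => K ((l n)⁻¹ • (x - y))) ⁻¹' Iic (c / 4) := by
      intro y hy
      refine (le_abs_self _).trans (hfar _ ?_)
      rw [hnorm, le_div_iff₀ hln]
      simpa using hy
    have h3 := measureReal_mono (μ := P) h2
    simp only [Function.comp_apply] at hup
    linarith
  have hbound : ∀ᵐ y ∂(P.map fun y => K ((l n)⁻¹ • (x - y))), |y| ≤ |M| + 1 := by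
    rw [ae_map_iff hf.aemeasurable (measurableSet_le (by fun_prop) (by fun_prop))]
    exact ae_of_all _ fun y => hM1 _
  set q := (P.map fun y => K ((l n)⁻¹ • (x - y))).real (Ici (c / 2))
  set r := (P.map fun y => K ((l n)⁻¹ • (x - y))).real (Iic (c / 4))
  have hq0 : 0 < q := lt_of_lt_of_le (by positivity) hq
  have hr0 : 0 < r := lt_of_lt_of_le (by norm_num) hr
  have hs : 0 < √(n * l n ^ v) := Real.sqrt_pos.2 (by positivity)
  set m := ∫ ω, ∑ i, K ((l n)⁻¹ • (x - X i ω)) ∂μ with hm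
  have hmain := measureReal_abs_sum_sub_le_of_iIndepFun hY hYindep hYlaw m
    (by positivity : 0 < |M| + 1) hbound (by linarith : c / 4 < c / 2) (mul_pos hC0 hs) hn hq0 hr0
  -- The bound `r ≥ 1 / 2` absorbs the factor `2`.
  have hsqrt : s₀ * √(n * l n ^ v) ≤ √(2 * n * (q * r)) := by
    rw [hs₀, ← Real.sqrt_mul (by positivity)]
    refine Real.sqrt_le_sqrt ?_
    have : p * t₀ ^ v * l n ^ v * (1 / 2) ≤ q * r := by gcongr
    nlinarith
  have hprob : μ.real {ω | |∑ i, K ((l n)⁻¹ • (x - X i ω)) - m| ≤ C * √(n * l n ^ v)} ≤ δ := by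
    refine hmain.trans ?_
    have h1 : C * √(n * l n ^ v) * Real.pi / ((c / 2 - c / 4) * √(2 * n * (q * r))) ≤
        C * √(n * l n ^ v) * Real.pi / ((c / 2 - c / 4) * (s₀ * √(n * l n ^ v))) := by
      have : 0 < c / 2 - c / 4 := by linarith
      gcongr
    have h2 : Real.exp (1 / 2) *
        (C * √(n * l n ^ v) * Real.pi / ((c / 2 - c / 4) * (s₀ * √(n * l n ^ v)))) = δ / 2 := by
      rw [hC, show c / 2 - c / 4 = c / 4 by ring]
      field_simp
      norm_num
    have h3 : (2 * (|M| + 1) / (C * √(n * l n ^ v) * Real.pi)) ^ 2 =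
        (2 * (|M| + 1) / (C * Real.pi)) ^ 2 / (n * l n ^ v) := by
      rw [mul_right_comm, ← div_div, div_pow _ (√(n * l n ^ v)), Real.sq_sqrt (by positivity)]
    rw [h3, mul_add]
    have h4 := mul_le_mul_of_nonneg_left h1 (Real.exp_nonneg (1 / 2))
    linarith
  have hS : Measurable fun ω => ∑ i, K ((l n)⁻¹ • (x - X i ω)) :=
    Finset.measurable_sum _ fun i _ => hY i
  have hmeas : MeasurableSet
      {ω | |∑ i, K ((l n)⁻¹ • (x - X i ω)) - m| ≤ C * √(n * l n ^ v)} :=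
    measurableSet_le (by fun_prop) measurable_const
  refine ⟨_, hmeas.compl, ?_, fun ω hω => ?_⟩
  · rw [← ofReal_measureReal, probReal_compl_eq_one_sub hmeas]
    exact ENNReal.ofReal_le_ofReal (by linarith)
  · rw [sqrt_one_div_mul_rpow_sub d hn' hln, mul_left_comm]
    exact ofReal_le_kdeRayDeviation hx (by positivity) (lt_of_not_ge fun h => hω h).le
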